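/- A combinatorial map \(M\) consists of a connected finite cubic graph \(C_M\) together with two disjoint perfect matchings \(v_M\) and \(f_M\) such that every component of the subgraph formed by \(v_M\cup f_M\) is a polygon with four edges (a square). Let \(a_M=E(C_M)\setminus(v_M\cup f_M)\) be the third perfect matching, and let \(z_M\) be the perfect matching formed by the diagonals of the squares. The components of \(a_M\cup v_M\), \(a_M\cup f_M\), \(a_M\cup z_M\) are called the \(v\)-gons, the \(f\)-gons and the \(z\)-gons (zigzags) of \(M\). The dual \(D\), the phial \(P\) and the antimap \(M^\sim\) of \(M\) are obtained from \(M\) by exchanging \(v_M\) with \(f_M\), \(v_M\) with \(z_M\), and \(f_M\) with \(z_M\), respectively; thus \(P^\sim\) is the phial of \(D\). All these maps have the same set \(E\) of squares. The graph \(G_M\) has the \(v\)-gons of \(M\) as vertices and the squares as edges; the two ends of a square are the two (possibly equal) \(v\)-gons that contain its two \(v_M\)-edges. The power set \(\mathcal E\) of \(E\), with symmetric difference as addition, is a vector space over \(GF(2)\). The bond space of a graph \(G\) with edge set \(E\) is the subspace of \(\mathcal E\) generated by the sets \(\delta_G(W)\) of the edges with one end in \(W\) and the other end outside \(W\), for \(W\subseteq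 V(G)\). The cycle space of \(G\) consists of the sets of edges that have even degree at every vertex, loops being counted twice. Suppose that \(M\) has a single zigzag. The zigzag is a closed path in \(G_M\) that visits every edge exactly twice: the passage along a \(z_M\)-edge from the corner \(p\) to the opposite corner of a square traverses this square, as an edge of \(G_M\), from the end at the \(v_M\)-edge through \(p\) to the other end. Record the cyclic sequence of the edges that it visits, with signs: the first traversal of an edge is positive, and the second one is positive or negative according to whether it has the same direction as the first or the opposite direction. For \(x\in E\), let \(i_P(x)\) be the set of edges that occur exactly once in this cyclic sequence between the two occurrences of \(x\); let \(\kappa_P(x)=\{x\}\) if \(x\) is traversed twice in the same direction, and \(\kappa_P(x)=\emptyset\) otherwise. Extend \(i_P\) and \(\kappa_P\) to linear maps \(\mathcal E\to\mathcal E\) and let \(c_P=\kappa_P+i_P\). Let \(c_{P^\sim}\) be the linear map obtained in the same way from the single zigzag of \(D\), which is the same polygon as the zigzag of \(M\), with its directions now read in \(G_D\). Theorem 2. Let \(M\) be a map with a single zigzag, \(D\) its dual and \(P\) its phial. Then (a) the image of \(c_P\) is the cycle space of \(G_M\); (b) the kernel of \(c_P\) is the bond space of \(G_M\); (c) the image of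 \(c_{P^\sim}\) is the cycle space of \(G_D\); (d) the kernel of \(c_{P^\sim}\) is the bond space of \(G_D\). -/

import Mathlib

noncomputable section

/-- A combinatorial map. `X` is the vertex set of the cubic graph, and its three perfect matchings
(the `v`-edges, the `f`-edges and the `a`-edges) are given by the fixed-point-free involutions that
exchange the two ends of each edge. The graph may have parallel edges (`a x = v x` is allowed).
The components of the `v`-edges and the `f`-edges are polygons with exactly four edges (the squares).
The squares are labelled bijectively by the type `E` through `rect`, so that maps with the same
squares have literally the same set `E` of edges. -/
structure CombMap (X E : Type*) where
  v : X → X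
  f : X → X
  a : X → X
  v_invol : Function.Involutive v
  f_invol : Function.Involutive f
  a_invol : Function.Involutive a
  v_ne : ∀ x, v x ≠ x
  f_ne : ∀ x, f x ≠ x
  a_ne : ∀ x, a x ≠ x
  /-- Together with `v_comm_f`: the component of `x` is the 4-cycle `x, v x, f (v x), f x`. -/
  v_ne_f : ∀ x, v x ≠ f x
  v_comm_f : ∀ x, v (f x) = f (v x)
  nonempty : Nonempty X
  connected : ∀ x y, Relation.ReflTransGen (fun p q => q = v p ∨ q = f p ∨ q = a p) x y
  rect : X → E
  rect_surj : Function.Surjective rect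
  rect_eq_iff : ∀ x y, rect x = rect y ↔ y = x ∨ y = v x ∨ y = f x ∨ y = v (f x)

namespace CombMap

variable {X E : Type*}

/-- The perfect matching formed by the diagonals of the squares. -/
def z (M : CombMap X E) (x : X) : X := M.v (M.f x)

theorem z_eq (M : CombMap X E) (x : X) : M.z x = M.f (M.v x) := M.v_comm_f x

theorem v_z (M : CombMap X E) (x : X) : M.v (M.z x) = M.f x := M.v_invol _

theorem f_z (M : CombMap X E) (x : X) : M.f (M.z x) = M.v x := by
  rw [z_eq]; exact M.f_invol _

theorem z_f (M : CombMap X E) (x : X) : M.z (M.f x) = M.v x := by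
  rw [z, M.f_invol]

theorem z_invol (M : CombMap X E) : Function.Involutive M.z := fun x => by
  rw [z_eq, v_z]; exact M.f_invol _

theorem z_ne (M : CombMap X E) (x : X) : M.z x ≠ x := fun h => by
  have := M.v_z x
  rw [h] at this
  exact M.v_ne_f x this

/-- The dual map: the `v`-edges and the `f`-edges are exchanged. -/
def dual (M : CombMap X E) : CombMap X E where
  v := M.f
  f := M.v
  a := M.a
  v_invol := M.f_invol
  f_invol := M.v_invol
  a_invol := M.a_invol
  v_ne := M.f_ne
  f_ne := M.v_ne
  a_ne := M.a_ne
  v_ne_f := fun x => (M.v_ne_f x).symm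
  v_comm_f := fun x => (M.v_comm_f x).symm
  nonempty := M.nonempty
  connected := fun x y => by
    refine Relation.ReflTransGen.mono ?_ _ _ (M.connected x y)
    intro p q h
    tauto
  rect := M.rect
  rect_surj := M.rect_surj
  rect_eq_iff := fun x y => by rw [M.rect_eq_iff, M.v_comm_f]; tauto

/-- The phial map: the `v`-edges and the `z`-edges are exchanged. -/
def phial (M : CombMap X E) : CombMap X E where
  v := M.z
  f := M.f
  a := M.a
  v_invol := M.z_invol
  f_invol := M.f_invol
  a_invol := M.a_invol
  v_ne := M.z_ne
  f_ne := M.f_ne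
  a_ne := M.a_ne
  v_ne_f := fun x => M.v_ne (M.f x)
  v_comm_f := fun x => by rw [z_f, f_z]
  nonempty := M.nonempty
  connected := fun x y => by
    refine (M.connected x y).trans_induction_on (fun _ => .refl) ?_ (fun _ _ h k => h.trans k)
    rintro p q (rfl | rfl | rfl)
    · exact .tail (b := M.f p) (.single (Or.inr (Or.inl rfl))) (Or.inl (M.z_f p).symm)
    · exact .single (Or.inr (Or.inl rfl))
    · exact .single (Or.inr (Or.inr rfl))
  rect := M.rect
  rect_surj := M.rect_surj
  rect_eq_iff := fun x y => by
    rw [M.rect_eq_iff, M.z_f]; change (_ ∨ _ ∨ _ ∨ y = M.z x) ↔ _; tauto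

/-- The antimap: the `f`-edges and the `z`-edges are exchanged. -/
def anti (M : CombMap X E) : CombMap X E where
  v := M.v
  f := M.z
  a := M.a
  v_invol := M.v_invol
  f_invol := M.z_invol
  a_invol := M.a_invol
  v_ne := M.v_ne
  f_ne := M.z_ne
  a_ne := M.a_ne
  v_ne_f := fun x h => M.f_ne (M.v x) (by rw [← z_eq, ← h])
  v_comm_f := fun x => by rw [v_z, z_eq, M.v_invol]
  nonempty := M.nonempty
  connected := fun x y => by
    refine (M.connected x y).trans_induction_on (fun _ => .refl) ?_ (fun _ _ h k => h.trans k)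
    rintro p q (rfl | rfl | rfl)
    · exact .single (Or.inl rfl)
    · exact .tail (b := M.z p) (.single (Or.inr (Or.inl rfl))) (Or.inl (M.v_z p).symm)
    · exact .single (Or.inr (Or.inr rfl))
  rect := M.rect
  rect_surj := M.rect_surj
  rect_eq_iff := fun x y => by
    rw [M.rect_eq_iff, M.v_z]; change (_ ∨ _ ∨ _ ∨ y = M.z x) ↔ _; tauto

theorem phial_phial (M : CombMap X E) : M.phial.phial = M := by
  have h : M.phial.phial.v = M.v := funext fun x => M.z_f x
  cases M
  simp only [phial, mk.injEq] at h ⊢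
  exact ⟨h, trivial, trivial, trivial⟩

theorem phial_anti_phial (M : CombMap X E) : M.phial.anti.phial = M.dual := by
  have h1 : M.phial.anti.phial.v = M.f := funext fun x => by
    change M.z (M.z (M.f x)) = M.f x
    exact M.z_invol _
  have h2 : M.phial.anti.phial.f = M.v := funext fun x => M.z_f x
  cases M
  simp only [phial, anti, dual, mk.injEq] at h1 h2 ⊢
  exact ⟨h1, h2, trivial, trivial⟩

/-- The `v`-gons: components of the subgraph formed by the `v`-edges and the `a`-edges. -/
def VGon (M : CombMap X E) : Type _ := Quot (fun p q : X => q = M.v p ∨ q = M.a p)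

/-- The `z`-gons (zigzags): components of the subgraph formed by the `z`-edges and the `a`-edges. -/
def ZGon (M : CombMap X E) : Type _ := Quot (fun p q : X => q = M.z p ∨ q = M.a p)

/-- The map has exactly one zigzag. -/
def SingleZigzag (M : CombMap X E) : Prop := Nat.card M.ZGon = 1

/-- The `v`-gon through a vertex of the cubic graph. -/
def vGon (M : CombMap X E) (x : X) : M.VGon := Quot.mk _ x

theorem vGon_v (M : CombMap X E) (x : X) : M.vGon (M.v x) = M.vGon x :=
  (Quot.sound (r := fun p q : X => q = M.v p ∨ q = M.a p) (Or.inl rfl)).symm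

/-- The graph `G_M` induced by a map: its vertices are the `v`-gons, its edges are the squares, and
the two ends of a square are the `v`-gons that contain its two `v`-edges, which are
`{x, v x}` and `{f x, f (v x)}` for any corner `x` of the square. -/
def graph (M : CombMap X E) : Graph M.VGon E where
  vertexSet := Set.univ
  IsLink e u w := ∃ x, M.rect x = e ∧ M.vGon x = u ∧ M.vGon (M.f x) = w
  isLink_symm := fun e _ => ⟨by
    rintro u w ⟨x, rfl, rfl, rfl⟩
    exact ⟨M.f x, (M.rect_eq_iff _ _).2 (by rw [M.f_invol]; tauto), rfl, by rw [M.f_invol]⟩⟩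
  eq_or_eq_of_isLink_of_isLink := by
    rintro e _ _ _ _ ⟨x, rfl, rfl, rfl⟩ ⟨y, hy, rfl, rfl⟩
    rcases (M.rect_eq_iff _ _).1 hy.symm with rfl | rfl | rfl | rfl
    · exact Or.inl rfl
    · exact Or.inl (M.vGon_v x).symm
    · exact Or.inr (by rw [M.f_invol])
    · exact Or.inr (by rw [← M.v_comm_f, M.f_invol, M.vGon_v])
  left_mem_of_isLink := fun _ _ _ _ => Set.mem_univ _

end CombMap

/-- The vector over GF(2) of a set of edges; symmetric difference of sets becomes addition. -/
def edgeVec {E : Type*} (A : Set E) : E → ZMod 2 := A.indicator 1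

/-- `δ_G(W)`: the edges with an end in `W` and an end outside `W`. -/
def Graph.bondOf {V E : Type*} (G : Graph V E) (W : Set V) : Set E :=
  {e | ∃ u w, G.IsLink e u w ∧ u ∈ W ∧ w ∉ W}

/-- The bond space of `G` over GF(2), generated by the bonds `δ_G(W)`, `W` a set of vertices. -/
def Graph.bondSpace {V E : Type*} (G : Graph V E) : Submodule (ZMod 2) (E → ZMod 2) :=
  Submodule.span (ZMod 2) {A | ∃ W : Set V, W ⊆ G.vertexSet ∧ A = edgeVec (G.bondOf W)}

open Classical in
/-- The cycle space of `G` over GF(2): the sets of edges of `G` that have even degree at every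
vertex. A loop contributes 2 to the degree of its vertex, that is, 0 in GF(2). -/
def Graph.cycleSpace {V E : Type*} [Fintype E] (G : Graph V E) :
    Submodule (ZMod 2) (E → ZMod 2) where
  carrier := {A | (∀ e, e ∉ G.edgeSet → A e = 0) ∧
    ∀ x ∈ G.vertexSet, ∑ e with G.IsNonloopAt e x, A e = 0}
  zero_mem' := by simp
  add_mem' := by
    rintro A B ⟨hA, hA'⟩ ⟨hB, hB'⟩
    refine ⟨fun e he => by simp [hA e he, hB e he], fun x hx => ?_⟩
    simp [Finset.sum_add_distrib, hA' x hx, hB' x hx]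
  smul_mem' := by
    rintro c A ⟨hA, hA'⟩
    refine ⟨fun e he => by simp [hA e he], fun x hx => ?_⟩
    simp [← Finset.mul_sum, hA' x hx]

/-- For a signed sequence `s`: the set of edges that occur exactly once strictly between the two
occurrences of `x`. -/
def betweenSet {E : Type*} {N : ℕ} (s : Fin N → E × ℤˣ) (x : E) : Set E :=
  {y | ∃ i j, i < j ∧ (s i).1 = x ∧ (s j).1 = x ∧ ∃! k, i < k ∧ k < j ∧ (s k).1 = y}

/-- For a signed sequence `s`: the set `{x}` if the two occurrences of `x` have the same sign, and
the empty set otherwise. -/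
def sameSignSet {E : Type*} {N : ℕ} (s : Fin N → E × ℤˣ) (x : E) : Set E :=
  {y | y = x ∧ ∃ i j, i < j ∧ (s i).1 = x ∧ (s j).1 = x ∧ (s i).2 = (s j).2}

namespace CombMap

variable {X E : Type*}

/-- Walk along the `z`-gon that starts at `b` with a `z`-edge: the `k`-th `z`-edge of the walk is
traversed from `zigzagFlag b k` to its other end, and then an `a`-edge is traversed. -/
def zigzagFlag (M : CombMap X E) (b : X) (k : ℕ) : X := (fun p => M.a (M.z p))^[k] b

open Classical in
/-- The sign of the `k`-th edge traversed by the zigzag. A passage that starts at the corner `p` of a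
square runs in `G_M` from the end at the `v`-edge `{p, v p}` to the opposite end. The first traversal
of an edge is positive; a later one is positive if and only if it has the same direction, that is,
if it starts at the same `v`-edge of the square. -/
def zigzagSign (M : CombMap X E) (b : X) (k : ℕ) : ℤˣ :=
  if ∀ j < k, M.rect (M.zigzagFlag b j) = M.rect (M.zigzagFlag b k) →
      M.zigzagFlag b k = M.zigzagFlag b j ∨ M.zigzagFlag b k = M.v (M.zigzagFlag b j)
  then 1 else -1

/-- The signed cyclic sequence of the edges visited by the zigzag of a map with a single zigzag,
written down from the starting corner `b` (all the starting points and both directions arise from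
the different choices of `b`). Each of the edges is visited twice, so the length is `2|E|`. -/
def zigzagSeq [Fintype E] (M : CombMap X E) (b : X) : Fin (2 * Fintype.card E) → E × ℤˣ :=
  fun k => (M.rect (M.zigzagFlag b k), M.zigzagSign b k)

/-- The linear map `i_P`, for a map `P` with a single `v`-gon, given on singletons and extended
linearly. The sequence is that of the single zigzag of the map `P.phial`, whose phial is `P`. -/
def iMap [Fintype E] (P : CombMap X E) (b : X) : (E → ZMod 2) →ₗ[ZMod 2] (E → ZMod 2) :=
  Fintype.linearCombination (ZMod 2) fun x => edgeVec (betweenSet (P.phial.zigzagSeq b) x)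

/-- The linear map `κ_P`, for a map `P` with a single `v`-gon. -/
def kappaMap [Fintype E] (P : CombMap X E) (b : X) : (E → ZMod 2) →ₗ[ZMod 2] (E → ZMod 2) :=
  Fintype.linearCombination (ZMod 2) fun x => edgeVec (sameSignSet (P.phial.zigzagSeq b) x)

/-- The linear map `c_P = κ_P + i_P`. -/
def cMap [Fintype E] (P : CombMap X E) (b : X) : (E → ZMod 2) →ₗ[ZMod 2] (E → ZMod 2) :=
  P.kappaMap b + P.iMap b

end CombMap

end

/-!
Let the single zigzag traverse the squares `e₀, e₁, …` starting from the corners `p₀, p₁, …`, where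
`pₖ₊₁ = a (z pₖ)`. As `z` and `a` are fixed-point-free involutions, the corners `pₖ` and `z pₖ` are
all distinct over one period and exhaust the cubic graph. Hence the period is `2|E|`, and each
square is traversed exactly twice, from corners `pᵢ` and `pⱼ` (`i < j`) with `pⱼ = v pᵢ` (same
direction) or `pⱼ = f pᵢ` (opposite direction): `CombMap.exists_occurrences`,
`CombMap.zigzagFlag_period`.

Interlacement of two edges in the cyclic sequence is a symmetric relation, so `c` has a symmetric
matrix (`CombMap.cMap_symm`). For a vector `A` of edges let `φ(k) = A(e₀) + ⋯ + A(eₖ₋₁)`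
(`CombMap.potential`). At a square that is traversed at the times `i < j`, the value of `c(A)` is
`φ(j) - φ(i)` if both traversals have the same direction and `φ(j) - φ(i + 1)` otherwise
(`CombMap.cMap_apply_eq_potential`). In both cases the two times are those at which the zigzag
is at the same end of the square. So `c(A) = 0` says precisely that `φ`, regarded as a function on
the corners, is constant on `v`-edges. It is always constant on `a`-edges, so `c(A) = 0` if and only
if `φ` descends to a function on the `v`-gons, that is, if and only if `A` is a bond of `G_M`
(`CombMap.ker_cMap`).

Since `c` is symmetric, its image is the orthogonal complement of its kernel
(`mem_range_iff_forall_mem_ker_dotProduct`), and the orthogonal complement of the bond space of a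
graph is its cycle space (`Graph.mem_cycleSpace_iff_forall_mem_bondSpace`). The statements about the
dual map are the same ones, because the dual has the same zigzag.
-/

/-! ### Symmetric matrices: the range is the orthogonal complement of the kernel -/

/-- For an endomorphism `c` of `ι → K` with a symmetric matrix, a vector that is orthogonal to the
kernel lies in the range (the other inclusion is immediate). -/
theorem mem_range_iff_forall_mem_ker_dotProduct {K ι : Type*} [Field K] [Fintype ι]
    (c : (ι → K) →ₗ[K] (ι → K)) (hc : ∀ A B, c A ⬝ᵥ B = A ⬝ᵥ c B) (C : ι → K) :
    C ∈ LinearMap.range c ↔ ∀ B ∈ LinearMap.ker c, B ⬝ᵥ C = 0 := by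
  classical
  constructor
  · rintro ⟨D, rfl⟩ B hB
    rw [← hc, LinearMap.mem_ker.1 hB, zero_dotProduct]
  · intro h
    let pair : (ι → K) →ₗ[K] K :=
      { toFun := fun B => B ⬝ᵥ C
        map_add' := fun A B => add_dotProduct A B C
        map_smul' := fun r A => smul_dotProduct r A C }
    have hpair : pair ∈ LinearMap.range c.dualMap := by
      rw [LinearMap.range_dualMap_eq_dualAnnihilator_ker, Submodule.mem_dualAnnihilator]
      exact h
    obtain ⟨g, hg⟩ := hpair
    refine ⟨fun i => g fun j => if i = j then 1 else 0, dotProduct_eq _ _ fun A => ?_⟩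
    rw [hc, dotProduct_comm]
    calc _ = g (c A) := (LinearMap.pi_apply_eq_sum_univ g (c A)).symm
      _ = A ⬝ᵥ C := LinearMap.congr_fun hg A
      _ = _ := dotProduct_comm _ _

/-! ### The cycle space of a graph is the orthogonal complement of its bond space -/

theorem edgeVec_apply {E : Type*} (A : Set E) (x : E) [Decidable (x ∈ A)] :
    edgeVec A x = if x ∈ A then 1 else 0 := by
  simp [edgeVec, Set.indicator_apply]

namespace Graph

variable {V E : Type*} {G : Graph V E}

theorem edgeVec_bondOf {e : E} {u w : V} (h : G.IsLink e u w) (W : Set V) :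
    edgeVec (G.bondOf W) e = edgeVec W u + edgeVec W w := by
  classical
  have key : e ∈ G.bondOf W ↔ (u ∈ W ∧ w ∉ W) ∨ (w ∈ W ∧ u ∉ W) := by
    constructor
    · rintro ⟨u', w', h', hu, hw⟩
      rcases h.eq_and_eq_or_eq_and_eq h' with ⟨rfl, rfl⟩ | ⟨rfl, rfl⟩ <;> tauto
    · rintro (⟨hu, hw⟩ | ⟨hw, hu⟩)
      · exact ⟨u, w, h, hu, hw⟩
      · exact ⟨w, u, h.symm, hw, hu⟩
  rw [edgeVec_apply, edgeVec_apply, edgeVec_apply, key]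
  by_cases hu : u ∈ W <;> by_cases hw : w ∈ W <;> simp [hu, hw, CharTwo.add_self_eq_zero]

theorem mem_bondOf_singleton {e : E} {x : V} : e ∈ G.bondOf {x} ↔ G.IsNonloopAt e x := by
  constructor
  · rintro ⟨u, w, h, rfl, hw⟩
    exact ⟨w, hw, h⟩
  · rintro ⟨w, hw, h⟩
    exact ⟨x, w, h, rfl, hw⟩

/-- A bond is the sum of the stars of the vertices on one of its sides: an edge inside
the side is counted twice. -/
theorem edgeVec_bondOf_eq_sum [Fintype V] (W : Set V) [DecidablePred (· ∈ W)] {e : E}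
    (he : e ∈ G.edgeSet) :
    edgeVec (G.bondOf W) e = ∑ x with x ∈ W, edgeVec (G.bondOf {x}) e := by
  classical
  obtain ⟨u, w, h⟩ := G.edge_mem_iff_exists_isLink e |>.1 he
  simp_rw [edgeVec_bondOf h, Finset.sum_add_distrib, edgeVec_apply, Set.mem_singleton_iff,
    Finset.sum_ite_eq, Finset.mem_filter_univ]

theorem mem_cycleSpace_iff_forall_mem_bondSpace [Finite V] [Fintype E] (A : E → ZMod 2) :
    A ∈ G.cycleSpace ↔ (∀ e, e ∉ G.edgeSet → A e = 0) ∧ ∀ B ∈ G.bondSpace, B ⬝ᵥ A = 0 := by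
  classical
  have := Fintype.ofFinite V
  have star (x : V) : edgeVec (G.bondOf {x}) ⬝ᵥ A = ∑ e with G.IsNonloopAt e x, A e := by
    simp [dotProduct, edgeVec_apply, mem_bondOf_singleton, Finset.sum_filter]
  change (_ ∧ _) ↔ _
  refine and_congr_right fun hA => ⟨fun h B hB => ?_, fun h x hx => ?_⟩
  · refine Submodule.span_induction (p := fun B _ => B ⬝ᵥ A = 0) ?_ (zero_dotProduct A)
      (fun B C _ _ hB hC => by rw [add_dotProduct, hB, hC, add_zero])
      (fun r B _ hB => by rw [smul_dotProduct, hB, smul_zero]) hB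
    rintro _ ⟨W, hW, rfl⟩
    calc _ = ∑ e, (∑ x with x ∈ W, edgeVec (G.bondOf {x}) e) * A e := by
          refine Finset.sum_congr rfl fun e _ => ?_
          by_cases he : e ∈ G.edgeSet
          · rw [edgeVec_bondOf_eq_sum W he]
          · rw [hA e he, mul_zero, mul_zero]
      _ = ∑ x with x ∈ W, edgeVec (G.bondOf {x}) ⬝ᵥ A := by
          simp_rw [Finset.sum_mul, dotProduct]
          exact Finset.sum_comm
      _ = 0 := Finset.sum_eq_zero fun x hx => by
          rw [star]
          exact h x (hW (Finset.mem_filter.1 hx).2)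
  · have := h _ (Submodule.subset_span ⟨{x}, Set.singleton_subset_iff.2 hx, rfl⟩)
    rw [star] at this
    convert this

end Graph

/-! ### Cyclic sequences in which every term occurs twice -/

section TwoOccurrences

variable {E : Type*} {N : ℕ} {s : Fin N → E × ℤˣ} {x y : E} {i j k l : Fin N}

/-- `i < j` are the only two places of the sequence `s` where `x` occurs. -/
def OccursAt (s : Fin N → E × ℤˣ) (x : E) (i j : Fin N) : Prop :=
  i < j ∧ ∀ m, (s m).1 = x ↔ m = i ∨ m = j

theorem OccursAt.eq_and_eq (h : OccursAt s x i j) (hkl : k < l) (hk : (s k).1 = x)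
    (hl : (s l).1 = x) : k = i ∧ l = j := by
  have h1 := (h.2 k).1 hk
  have h2 := (h.2 l).1 hl
  have := h.1
  grind

theorem OccursAt.mem_betweenSet_iff (h : OccursAt s x i j) :
    y ∈ betweenSet s x ↔ ∃! m, i < m ∧ m < j ∧ (s m).1 = y := by
  constructor
  · rintro ⟨k, l, hkl, hk, hl, hy⟩
    obtain ⟨rfl, rfl⟩ := h.eq_and_eq hkl hk hl
    exact hy
  · exact fun hy => ⟨i, j, h.1, (h.2 i).2 (.inl rfl), (h.2 j).2 (.inr rfl), hy⟩

theorem OccursAt.mem_sameSignSet_iff (h : OccursAt s x i j) :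
    y ∈ sameSignSet s x ↔ y = x ∧ (s i).2 = (s j).2 := by
  constructor
  · rintro ⟨hy, k, l, hkl, hk, hl, hs⟩
    obtain ⟨rfl, rfl⟩ := h.eq_and_eq hkl hk hl
    exact ⟨hy, hs⟩
  · exact fun ⟨hy, hs⟩ => ⟨hy, i, j, h.1, (h.2 i).2 (.inl rfl), (h.2 j).2 (.inr rfl), hs⟩

theorem OccursAt.mem_betweenSet_iff_xor (hx : OccursAt s x i j) (hy : OccursAt s y k l) :
    y ∈ betweenSet s x ↔ Xor (i < k ∧ k < j) (i < l ∧ l < j) := by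
  rw [hx.mem_betweenSet_iff]
  have hkl := hy.1.ne
  simp_rw [hy.2]
  constructor
  · rintro ⟨m, ⟨h1, h2, h3⟩, hu⟩
    have hk := hu k
    have hl := hu l
    grind [Xor]
  · rintro (⟨h1, h2⟩ | ⟨h1, h2⟩)
    · exact ⟨k, by grind, by grind⟩
    · exact ⟨l, by grind, by grind⟩

/-- Interlacement is a symmetric relation. -/
theorem mem_betweenSet_comm (hx : OccursAt s x i j) (hy : OccursAt s y k l) :
    y ∈ betweenSet s x ↔ x ∈ betweenSet s y := by
  rcases eq_or_ne x y with rfl | hxy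
  · rfl
  have hik : ∀ m, ¬ ((m = i ∨ m = j) ∧ (m = k ∨ m = l)) := fun m hm =>
    hxy (((hx.2 m).2 hm.1).symm.trans ((hy.2 m).2 hm.2))
  rw [hx.mem_betweenSet_iff_xor hy, hy.mem_betweenSet_iff_xor hx]
  have h1 := hx.1
  have h2 := hy.1
  have h3 := hik i
  have h4 := hik j
  grind [Xor]

theorem OccursAt.card_le_two [DecidableEq E] (hy : OccursAt s y k l) (S : Finset (Fin N)) :
    (S.filter fun m => (s m).1 = y).card ≤ 2 := by
  refine (Finset.card_le_card (t := {k, l}) fun m hm => ?_).trans Finset.card_le_two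
  simpa using (hy.2 m).1 (Finset.mem_filter.1 hm).2

/-- Modulo 2, the terms between the two occurrences of `x` sum up to the set of those that occur
exactly once there, since none occurs more than twice. -/
theorem OccursAt.dotProduct_betweenSet [Fintype E] (hs : ∀ y, ∃ k l, OccursAt s y k l)
    (hx : OccursAt s x i j) (A : E → ZMod 2) :
    A ⬝ᵥ edgeVec (betweenSet s x) = ∑ m ∈ Finset.Ioo i j, A (s m).1 := by
  classical
  rw [← Finset.sum_fiberwise (Finset.Ioo i j) (fun m => (s m).1)]
  refine Finset.sum_congr rfl fun y _ => ?_
  rw [Finset.sum_congr rfl (g := fun _ => A y) fun m hm => by rw [(Finset.mem_filter.1 hm).2],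
    Finset.sum_const, nsmul_eq_mul, mul_comm]
  congr 1
  obtain ⟨k, l, hy⟩ := hs y
  have hcard := hy.card_le_two (Finset.Ioo i j)
  have hone : y ∈ betweenSet s x ↔ ((Finset.Ioo i j).filter fun m => (s m).1 = y).card = 1 := by
    rw [hx.mem_betweenSet_iff, Finset.card_eq_one_iff_existsUnique]
    simp [and_assoc]
  rw [edgeVec_apply, hone]
  generalize ((Finset.Ioo i j).filter fun m => (s m).1 = y).card = c at hcard
  interval_cases c
  · simp
  · simp
  · simpa using (CharTwo.two_eq_zero (R := ZMod 2)).symm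

/-- In total, every term is counted twice. -/
theorem sum_eq_zero_of_occursAt [Fintype E] (hs : ∀ y, ∃ k l, OccursAt s y k l)
    (A : E → ZMod 2) : ∑ m, A (s m).1 = 0 := by
  classical
  rw [← Finset.sum_fiberwise Finset.univ (fun m => (s m).1)]
  refine Finset.sum_eq_zero fun y _ => ?_
  obtain ⟨k, l, hkl, hy⟩ := hs y
  have : Finset.univ.filter (fun m => (s m).1 = y) = {k, l} := by
    ext m
    simp [hy]
  rw [this, Finset.sum_pair hkl.ne, (hy k).2 (.inl rfl), (hy l).2 (.inr rfl),
    CharTwo.add_self_eq_zero]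

end TwoOccurrences

/-! ### The zigzag visits every square exactly twice -/

namespace CombMap

variable {X E : Type*} (M : CombMap X E) (b : X)

theorem zigzagFlag_succ (k : ℕ) : M.zigzagFlag b (k + 1) = M.a (M.z (M.zigzagFlag b k)) :=
  Function.iterate_succ_apply' _ _ _

theorem a_zigzagFlag_succ (k : ℕ) : M.a (M.zigzagFlag b (k + 1)) = M.z (M.zigzagFlag b k) := by
  rw [zigzagFlag_succ, M.a_invol]

/-- The zigzag is a polygon: a corner at which it enters a `z`-edge is never one at which it leaves
a `z`-edge. Otherwise some edge of the polygon would have equal ends. -/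
theorem zigzagFlag_ne_z (k m : ℕ) : M.zigzagFlag b k ≠ M.z (M.zigzagFlag b m) := by
  wlog hkm : k ≤ m generalizing k m
  · intro h
    exact this m k (by omega) (by rw [h, M.z_invol])
  induction hd : m - k using Nat.strong_induction_on generalizing k m with
  | _ d ih =>
    intro h
    obtain rfl | hlt := hkm.eq_or_lt
    · exact M.z_ne _ h.symm
    obtain ⟨m, rfl⟩ : ∃ m', m = m' + 1 := ⟨m - 1, by omega⟩
    have h' : M.zigzagFlag b (k + 1) = M.z (M.zigzagFlag b m) := by
      rw [zigzagFlag_succ, h, M.z_invol, a_zigzagFlag_succ]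
    obtain rfl | hlt' := (Nat.le_of_lt_succ hlt).eq_or_lt
    · exact M.a_ne _ ((M.zigzagFlag_succ b k).symm.trans h')
    · exact ih (m - (k + 1)) (by omega) (k + 1) m (by omega) rfl h'

theorem a_z_injective : Function.Injective fun p => M.a (M.z p) :=
  M.a_invol.injective.comp M.z_invol.injective

theorem exists_zigzagFlag_period [Finite X] : ∃ T, 0 < T ∧ M.zigzagFlag b T = b ∧
    ∀ k < T, ∀ l < T, M.zigzagFlag b k = M.zigzagFlag b l → k = l := by
  refine ⟨Function.minimalPeriod (fun p => M.a (M.z p)) b,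
    Function.minimalPeriod_pos_of_mem_periodicPts (M.a_z_injective.mem_periodicPts b),
    Function.iterate_minimalPeriod, fun k hk l hl h => ?_⟩
  exact (Function.iterate_eq_iterate_iff_of_lt_minimalPeriod hk hl).1 h

variable {M}

theorem zGon_eq (hM : M.SingleZigzag) (x y : X) :
    (Quot.mk _ x : M.ZGon) = Quot.mk _ y := by
  have : Subsingleton M.ZGon := (Nat.card_eq_one_iff_unique.1 hM).1
  exact Subsingleton.elim (α := M.ZGon) _ _

/-- The dual map has the same zigzags, since `v` and `f` commute. -/
theorem SingleZigzag.dual (hM : M.SingleZigzag) : M.dual.SingleZigzag := by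
  have hz : M.dual.z = M.z := funext fun x => (M.z_eq x).symm
  rw [SingleZigzag, ZGon, hz]
  exact hM

/-- The corners of the single zigzag, `zigzagFlag b k` and its `z`-neighbours, are all the vertices
of the cubic graph, because this set is closed under `z` and `a`. -/
theorem exists_zigzagFlag_eq_or_z (hM : M.SingleZigzag) {T : ℕ} (hT : 0 < T)
    (hper : M.zigzagFlag b T = b) (x : X) :
    ∃ k < T, x = M.zigzagFlag b k ∨ x = M.z (M.zigzagFlag b k) := by
  let S : X → Prop := fun x => ∃ k < T, x = M.zigzagFlag b k ∨ x = M.z (M.zigzagFlag b k)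
  have hz : ∀ x, S x → S (M.z x) := by
    rintro _ ⟨k, hk, rfl | rfl⟩
    · exact ⟨k, hk, .inr rfl⟩
    · exact ⟨k, hk, .inl (M.z_invol _)⟩
  have ha : ∀ x, S x → S (M.a x) := by
    rintro _ ⟨k, hk, rfl | rfl⟩
    · rcases k with _ | k
      · obtain ⟨T, rfl⟩ : ∃ T', T = T' + 1 := ⟨T - 1, by omega⟩
        refine ⟨T, by omega, .inr ?_⟩
        rw [← a_zigzagFlag_succ, hper]
        rfl
      · exact ⟨k, by omega, .inr (M.a_zigzagFlag_succ b k)⟩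
    · rw [← zigzagFlag_succ]
      obtain h | h := (Nat.succ_le_of_lt hk).eq_or_lt
      · exact ⟨0, hT, .inl (by rw [show k + 1 = T from h, hper]; rfl)⟩
      · exact ⟨k + 1, h, .inl rfl⟩
  let S' : M.ZGon → Prop := Quot.lift S fun p q h => propext <| by
    rcases h with rfl | rfl
    · exact ⟨hz p, fun h => by simpa [M.z_invol p] using hz _ h⟩
    · exact ⟨ha p, fun h => by simpa [M.a_invol p] using ha _ h⟩
  have hb : S' (Quot.mk _ b) := ⟨0, hT, .inl rfl⟩
  rw [zGon_eq hM b x] at hb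
  exact hb

/-- The zigzag traverses every square twice. If the first traversal starts at `p`, then the second
one starts at `v p` (same direction) or at `f p` (opposite direction). -/
theorem exists_occurrences (hM : M.SingleZigzag) {T : ℕ} (hT : 0 < T)
    (hper : M.zigzagFlag b T = b) (e : E) :
    ∃ i j, i < j ∧ j < T ∧ M.rect (M.zigzagFlag b i) = e ∧ M.rect (M.zigzagFlag b j) = e ∧
      (M.zigzagFlag b j = M.v (M.zigzagFlag b i) ∨
        M.zigzagFlag b j = M.f (M.zigzagFlag b i)) := by
  have hrep := exists_zigzagFlag_eq_or_z b hM hT hper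
  obtain ⟨x, rfl⟩ := M.rect_surj e
  obtain ⟨k, hk, hkx⟩ : ∃ k < T, M.rect (M.zigzagFlag b k) = M.rect x := by
    obtain ⟨k, hk, rfl | rfl⟩ := hrep x
    · exact ⟨k, hk, rfl⟩
    · exact ⟨k, hk, (M.rect_eq_iff _ _).2 (.inr (.inr (.inr rfl)))⟩
  obtain ⟨l, hl, hlk⟩ : ∃ l < T, M.zigzagFlag b l = M.v (M.zigzagFlag b k) ∨
      M.zigzagFlag b l = M.f (M.zigzagFlag b k) := by
    obtain ⟨l, hl, h | h⟩ := hrep (M.v (M.zigzagFlag b k))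
    · exact ⟨l, hl, .inl h.symm⟩
    · refine ⟨l, hl, .inr ?_⟩
      rw [← M.z_invol (M.zigzagFlag b l), ← h, z_eq, M.v_invol]
  have hlx : M.rect (M.zigzagFlag b l) = M.rect x := by
    rw [← hkx, eq_comm, M.rect_eq_iff]
    tauto
  rcases lt_trichotomy k l with h | rfl | h
  · exact ⟨k, l, h, hl, hkx, hlx, hlk⟩
  · rcases hlk with h | h
    · exact absurd h.symm (M.v_ne _)
    · exact absurd h.symm (M.f_ne _)
  · refine ⟨l, k, h, hk, hlx, hkx, hlk.imp (fun h => ?_) (fun h => ?_)⟩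
    · rw [h, M.v_invol]
    · rw [h, M.f_invol]

theorem eq_or_eq_of_rect_eq {T i j k : ℕ}
    (hinj : ∀ k < T, ∀ l < T, M.zigzagFlag b k = M.zigzagFlag b l → k = l)
    (hi : i < T) (hj : j < T) (hk : k < T)
    (hij : M.zigzagFlag b j = M.v (M.zigzagFlag b i) ∨ M.zigzagFlag b j = M.f (M.zigzagFlag b i))
    (h : M.rect (M.zigzagFlag b i) = M.rect (M.zigzagFlag b k)) : k = i ∨ k = j := by
  rcases (M.rect_eq_iff _ _).1 h with h | h | h | h
  · exact .inl (hinj _ hk _ hi h)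
  · rcases hij with h' | h'
    · exact .inr (hinj _ hk _ hj (h.trans h'.symm))
    · refine absurd (?_ : _ = M.z _) (M.zigzagFlag_ne_z b k j)
      rw [h, h', M.z_f]
  · rcases hij with h' | h'
    · refine absurd (?_ : _ = M.z _) (M.zigzagFlag_ne_z b k j)
      rw [h, h', z_eq, M.v_invol]
    · exact .inr (hinj _ hk _ hj (h.trans h'.symm))
  · exact absurd h (M.zigzagFlag_ne_z b k i)

/-- The period of the zigzag is `2|E|`, as every square is traversed exactly twice. -/
theorem zigzagFlag_period [Finite X] [Fintype E] (hM : M.SingleZigzag) :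
    M.zigzagFlag b (2 * Fintype.card E) = b ∧ ∀ k < 2 * Fintype.card E,
      ∀ l < 2 * Fintype.card E, M.zigzagFlag b k = M.zigzagFlag b l → k = l := by
  classical
  obtain ⟨T, hT, hper, hinj⟩ := M.exists_zigzagFlag_period b
  suffices h : T = 2 * Fintype.card E by
    rw [← h]
    exact ⟨hper, hinj⟩
  have hfib : ∀ e : E, ((Finset.range T).filter fun k => M.rect (M.zigzagFlag b k) = e).card = 2 := by
    intro e
    obtain ⟨i, j, hij, hj, rfl, hj', h⟩ := exists_occurrences b hM hT hper e
    rw [Finset.card_eq_two]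
    refine ⟨i, j, hij.ne, ?_⟩
    ext k
    simp only [Finset.mem_filter, Finset.mem_range, Finset.mem_insert, Finset.mem_singleton]
    constructor
    · rintro ⟨hk, hk'⟩
      exact eq_or_eq_of_rect_eq b hinj (hij.trans hj) hj hk h hk'.symm
    · rintro (rfl | rfl)
      · exact ⟨hij.trans hj, rfl⟩
      · exact ⟨hj, hj'⟩
  calc T = (Finset.range T).card := (Finset.card_range T).symm
    _ = ∑ e : E, ((Finset.range T).filter fun k => M.rect (M.zigzagFlag b k) = e).card :=
      Finset.card_eq_sum_card_fiberwise fun _ _ => Finset.mem_coe.2 (Finset.mem_univ _)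
    _ = 2 * Fintype.card E := by simp [hfib, mul_comm]

theorem two_mul_card_pos [Fintype E] (b : X) (M : CombMap X E) : 0 < 2 * Fintype.card E :=
  Nat.mul_pos two_pos (Fintype.card_pos_iff.2 ⟨M.rect b⟩)

theorem occursAt_zigzagSeq [Finite X] [Fintype E] (hM : M.SingleZigzag)
    {i j : Fin (2 * Fintype.card E)} (hij : i < j)
    (h : M.zigzagFlag b j = M.v (M.zigzagFlag b i) ∨ M.zigzagFlag b j = M.f (M.zigzagFlag b i)) :
    OccursAt (M.zigzagSeq b) (M.rect (M.zigzagFlag b i)) i j := by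
  refine ⟨hij, fun k => ⟨fun hk => ?_, ?_⟩⟩
  · simpa only [Fin.ext_iff] using
      eq_or_eq_of_rect_eq b (zigzagFlag_period b hM).2 i.2 j.2 k.2 h hk.symm
  · rintro (rfl | rfl)
    · rfl
    · exact ((M.rect_eq_iff _ _).2 (by tauto)).symm

theorem exists_occursAt_zigzagSeq [Finite X] [Fintype E] (hM : M.SingleZigzag) (e : E) :
    ∃ i j, OccursAt (M.zigzagSeq b) e i j ∧
      (M.zigzagFlag b j = M.v (M.zigzagFlag b i) ∨
        M.zigzagFlag b j = M.f (M.zigzagFlag b i)) := by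
  obtain ⟨i, j, hij, hj, rfl, -, h⟩ :=
    exists_occurrences b hM (two_mul_card_pos b M) (zigzagFlag_period b hM).1 e
  exact ⟨⟨i, hij.trans hj⟩, ⟨j, hj⟩, occursAt_zigzagSeq b hM hij h, h⟩

/-- The two traversals of a square have the same sign if and only if the second one starts at the
same `v`-edge as the first. -/
theorem zigzagSeq_sign_eq_iff [Finite X] [Fintype E] (hM : M.SingleZigzag) {e : E}
    {i j : Fin (2 * Fintype.card E)} (h : OccursAt (M.zigzagSeq b) e i j) :
    (M.zigzagSeq b i).2 = (M.zigzagSeq b j).2 ↔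
      M.zigzagFlag b j = M.v (M.zigzagFlag b i) := by
  have hocc : ∀ k : ℕ, k < j → (M.rect (M.zigzagFlag b k) = e ↔ k = i) := by
    intro k hk
    have := h.2 ⟨k, hk.trans j.2⟩
    simp only [Fin.ext_iff, hk.ne, or_false] at this
    exact this
  have hi : M.rect (M.zigzagFlag b i) = e := (h.2 i).2 (.inl rfl)
  have hj : M.rect (M.zigzagFlag b j) = e := (h.2 j).2 (.inr rfl)
  have hij : (i : ℕ) < j := h.1
  have hsi : (M.zigzagSeq b i).2 = 1 := by
    refine if_pos fun k hk hr => absurd ((hocc k (hk.trans hij)).1 (hr.trans hi)) hk.ne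
  have hne : M.zigzagFlag b j ≠ M.zigzagFlag b i := fun h =>
    hij.ne' ((zigzagFlag_period b hM).2 _ j.2 _ i.2 h)
  have hsj : (∀ k < (j : ℕ), M.rect (M.zigzagFlag b k) = M.rect (M.zigzagFlag b j) →
      M.zigzagFlag b j = M.zigzagFlag b k ∨ M.zigzagFlag b j = M.v (M.zigzagFlag b k)) ↔
      M.zigzagFlag b j = M.v (M.zigzagFlag b i) := by
    constructor
    · exact fun hk => (hk i hij (hi.trans hj.symm)).resolve_left hne
    · rintro hv k hk hr
      rw [(hocc k hk).1 (hr.trans hj)]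
      exact .inr hv
  rw [hsi, ← hsj, eq_comm]
  refine ⟨fun h1 => ?_, fun hk => if_pos hk⟩
  by_contra hk
  have h2 : (M.zigzagSeq b j).2 = -1 := if_neg hk
  exact absurd (h1.symm.trans h2) (by decide)

end CombMap

/-! ### Sums along the zigzag -/

namespace CombMap

variable {X E : Type*} {M P : CombMap X E} (b : X)

theorem isLink_graph (x : X) : M.graph.IsLink (M.rect x) (M.vGon x) (M.vGon (M.f x)) :=
  ⟨x, rfl, rfl, rfl⟩

theorem vGon_a (x : X) : M.vGon (M.a x) = M.vGon x :=
  (Quot.sound (r := fun p q : X => q = M.v p ∨ q = M.a p) (.inr rfl)).symm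

theorem vGon_z (x : X) : M.vGon (M.z x) = M.vGon (M.f x) := M.vGon_v _

variable (M) in
/-- The sum of the values of `A` on the first `k` edges of the zigzag that starts at `b`. -/
def potential (A : E → ZMod 2) (k : ℕ) : ZMod 2 :=
  ∑ l ∈ Finset.range k, A (M.rect (M.zigzagFlag b l))

theorem potential_succ (A : E → ZMod 2) (k : ℕ) :
    M.potential b A (k + 1) = M.potential b A k + A (M.rect (M.zigzagFlag b k)) :=
  Finset.sum_range_succ _ _

/-- The potential of a bond `δ(W)` tells whether the zigzag is on the same side of the bond as at
its start. -/
theorem potential_bondOf (W : Set M.VGon) (k : ℕ) :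
    M.potential b (edgeVec (M.graph.bondOf W)) k =
      edgeVec W (M.vGon (M.zigzagFlag b k)) - edgeVec W (M.vGon b) := by
  induction k with
  | zero => simp [potential, zigzagFlag]
  | succ k ih =>
    rw [potential_succ, ih, Graph.edgeVec_bondOf (isLink_graph _), zigzagFlag_succ, vGon_a, vGon_z,
      ← CharTwo.sub_eq_add (edgeVec W (M.vGon (M.zigzagFlag b k)))]
    rw [← CharTwo.neg_eq (edgeVec W (M.vGon (M.zigzagFlag b k)) -
      edgeVec W (M.vGon (M.f (M.zigzagFlag b k))))]
    ring

/-! ### The map `c` is symmetric -/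

variable [Fintype E]

theorem cMap_single (hP : P.phial = M) (x : E) [DecidableEq E] :
    P.cMap b (Pi.single x 1) = edgeVec (sameSignSet (M.zigzagSeq b) x) +
      edgeVec (betweenSet (M.zigzagSeq b) x) := by
  subst hP
  simp [cMap, kappaMap, iMap]

variable [Finite X]

/-- By definition the columns of the matrix of `c_P` are the vectors `κ_P(x) + i_P(x)`; so are its
rows, since interlacement is symmetric. -/
theorem cMap_apply (hP : P.phial = M) (hM : M.SingleZigzag) (A : E → ZMod 2) (x : E) :
    P.cMap b A x = A ⬝ᵥ (edgeVec (sameSignSet (M.zigzagSeq b) x) +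
      edgeVec (betweenSet (M.zigzagSeq b) x)) := by
  classical
  subst hP
  simp only [cMap, kappaMap, iMap, LinearMap.add_apply, Fintype.linearCombination_apply,
    Pi.add_apply, Finset.sum_apply, Pi.smul_apply, smul_eq_mul, dotProduct_add]
  congr 1
  · refine Finset.sum_congr rfl fun y _ => ?_
    have : x ∈ sameSignSet (P.phial.zigzagSeq b) y ↔ y ∈ sameSignSet (P.phial.zigzagSeq b) x := by
      constructor <;>
      · rintro ⟨rfl, h⟩
        exact ⟨rfl, h⟩
    rw [edgeVec_apply, edgeVec_apply, this]
  · refine Finset.sum_congr rfl fun y _ => ?_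
    obtain ⟨i, j, hx, -⟩ := exists_occursAt_zigzagSeq b hM x
    obtain ⟨k, l, hy, -⟩ := exists_occursAt_zigzagSeq b hM y
    rw [edgeVec_apply, edgeVec_apply, mem_betweenSet_comm hy hx]

theorem cMap_symm (hP : P.phial = M) (hM : M.SingleZigzag) (A B : E → ZMod 2) :
    P.cMap b A ⬝ᵥ B = A ⬝ᵥ P.cMap b B := by
  classical
  suffices h : (dotProductBilin (ZMod 2) (ZMod 2)).comp (P.cMap b) =
      (dotProductBilin (ZMod 2) (ZMod 2)).compl₂ (P.cMap b) from
    LinearMap.congr_fun (LinearMap.congr_fun h A) B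
  refine LinearMap.pi_ext' fun x => LinearMap.ext_ring (LinearMap.ext fun B => ?_)
  change P.cMap b (Pi.single x 1) ⬝ᵥ B = Pi.single x 1 ⬝ᵥ P.cMap b B
  rw [single_dotProduct, one_mul, cMap_apply b hP hM, cMap_single b hP, dotProduct_comm]

/-! ### The kernel of `c` is the bond space -/

theorem potential_period (hM : M.SingleZigzag) (A : E → ZMod 2) :
    M.potential b A (2 * Fintype.card E) = 0 := by
  rw [potential, Finset.sum_range]
  refine sum_eq_zero_of_occursAt (s := M.zigzagSeq b) (fun y => ?_) A
  obtain ⟨i, j, h, -⟩ := exists_occursAt_zigzagSeq b hM y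
  exact ⟨i, j, h⟩

/-- `c_P(A)` at a square is the increment of the potential of `A` along the closed walk in `G_M`
between the two traversals of this square; the walk contains the square itself exactly
if both traversals have the same direction. -/
theorem cMap_apply_eq_potential (hP : P.phial = M) (hM : M.SingleZigzag) (A : E → ZMod 2)
    {i j : Fin (2 * Fintype.card E)} (hij : i < j)
    (h : M.zigzagFlag b j = M.v (M.zigzagFlag b i) ∨ M.zigzagFlag b j = M.f (M.zigzagFlag b i)) :
    (M.zigzagFlag b j = M.v (M.zigzagFlag b i) →
      P.cMap b A (M.rect (M.zigzagFlag b i)) = M.potential b A j - M.potential b A i) ∧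
    (M.zigzagFlag b j = M.f (M.zigzagFlag b i) →
      P.cMap b A (M.rect (M.zigzagFlag b i)) = M.potential b A j - M.potential b A (i + 1)) := by
  classical
  have hocc := occursAt_zigzagSeq b hM hij h
  have hsign := zigzagSeq_sign_eq_iff b hM hocc
  have hsum : ∑ m ∈ Finset.Ioo i j, A ((M.zigzagSeq b m).1) =
      M.potential b A j - M.potential b A (i + 1) := by
    rw [potential, potential, ← Finset.sum_Ico_eq_sub _ (Nat.succ_le_of_lt hij)]
    have := Finset.sum_map (Finset.Ioo i j) Fin.valEmbedding
      fun l => A (M.rect (M.zigzagFlag b l))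
    rw [Fin.map_valEmbedding_Ioo] at this
    exact this.symm
  rw [cMap_apply b hP hM, dotProduct_add, hocc.dotProduct_betweenSet
    (fun y => by obtain ⟨k, l, h, -⟩ := exists_occursAt_zigzagSeq b hM y; exact ⟨k, l, h⟩), hsum]
  have hsame : A ⬝ᵥ edgeVec (sameSignSet (M.zigzagSeq b) (M.rect (M.zigzagFlag b i))) =
      if M.zigzagFlag b j = M.v (M.zigzagFlag b i) then A (M.rect (M.zigzagFlag b i)) else 0 := by
    simp only [dotProduct, edgeVec_apply, hocc.mem_sameSignSet_iff, hsign]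
    split_ifs with hv <;> simp [hv]
  rw [hsame]
  constructor
  · intro hv
    rw [if_pos hv, potential_succ]
    ring
  · intro hf
    rw [if_neg fun hv => M.v_ne_f _ (hv.symm.trans hf), zero_add]

/-- `A` lies in the kernel of `c` if and only if its potential takes equal values at the two times
at which the traversals of a square touch the same end of it. -/
theorem mem_ker_cMap_iff (hP : P.phial = M) (hM : M.SingleZigzag) (A : E → ZMod 2) :
    A ∈ LinearMap.ker (P.cMap b) ↔ ∀ i j, i < j → j < 2 * Fintype.card E →
      (M.zigzagFlag b j = M.v (M.zigzagFlag b i) → M.potential b A j = M.potential b A i) ∧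
      (M.zigzagFlag b j = M.f (M.zigzagFlag b i) →
        M.potential b A j = M.potential b A (i + 1)) := by
  rw [LinearMap.mem_ker]
  constructor
  · intro hA i j hij hj
    have key := cMap_apply_eq_potential b hP hM A (i := ⟨i, hij.trans hj⟩) (j := ⟨j, hj⟩) hij
    simp only [hA, Pi.zero_apply] at key
    exact ⟨fun hv => sub_eq_zero.1 ((key (.inl hv)).1 hv).symm,
      fun hf => sub_eq_zero.1 ((key (.inr hf)).2 hf).symm⟩
  · intro h
    ext e
    obtain ⟨i, j, hocc, hij⟩ := exists_occursAt_zigzagSeq b hM e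
    obtain rfl : M.rect (M.zigzagFlag b i) = e := (hocc.2 i).2 (.inl rfl)
    have key := cMap_apply_eq_potential b hP hM A hocc.1 hij
    rcases hij with hv | hf
    · rw [key.1 hv, (h i j hocc.1 j.2).1 hv, sub_self, Pi.zero_apply]
    · rw [key.2 hf, (h i j hocc.1 j.2).2 hf, sub_self, Pi.zero_apply]

theorem bondSpace_le_ker_cMap (hP : P.phial = M) (hM : M.SingleZigzag) :
    M.graph.bondSpace ≤ LinearMap.ker (P.cMap b) := by
  refine Submodule.span_le.2 ?_
  rintro _ ⟨W, -, rfl⟩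
  refine (mem_ker_cMap_iff b hP hM _).2 fun i j _ _ => ⟨fun hv => ?_, fun hf => ?_⟩
  · rw [potential_bondOf, potential_bondOf, hv, vGon_v]
  · rw [potential_bondOf, potential_bondOf, hf, zigzagFlag_succ, vGon_a, vGon_z]

/-- The potential of `A` as a function on the corners of the zigzag. -/
theorem exists_potential_on_corners (hM : M.SingleZigzag) (A : E → ZMod 2) :
    ∃ ψ : X → ZMod 2, ∀ k < 2 * Fintype.card E, ψ (M.zigzagFlag b k) = M.potential b A k ∧
      ψ (M.z (M.zigzagFlag b k)) = M.potential b A (k + 1) := by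
  obtain ⟨hper, hinj⟩ := zigzagFlag_period b hM
  have hval (x : X) : ∃ t, ∀ k < 2 * Fintype.card E,
      (M.zigzagFlag b k = x → t = M.potential b A k) ∧
      (M.z (M.zigzagFlag b k) = x → t = M.potential b A (k + 1)) := by
    obtain ⟨k, hk, rfl | rfl⟩ := exists_zigzagFlag_eq_or_z b hM (two_mul_card_pos b M) hper x
    · refine ⟨M.potential b A k, fun l hl => ⟨fun h => ?_, fun h => ?_⟩⟩
      · rw [hinj _ hl _ hk h]
      · exact absurd h.symm (M.zigzagFlag_ne_z b _ _)
    · refine ⟨M.potential b A (k + 1), fun l hl => ⟨fun h => ?_, fun h => ?_⟩⟩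
      · exact absurd h (M.zigzagFlag_ne_z b _ _)
      · rw [hinj _ hl _ hk (M.z_invol.injective h)]
  choose ψ hψ using hval
  exact ⟨ψ, fun k hk => ⟨(hψ _ k hk).1 rfl, (hψ _ k hk).2 rfl⟩⟩

/-- If `A` is in the kernel of `c`, its potential descends to a function on the `v`-gons, and `A` is
the bond defined by the `v`-gons of potential 1. -/
theorem ker_cMap_le_bondSpace (hP : P.phial = M) (hM : M.SingleZigzag) :
    LinearMap.ker (P.cMap b) ≤ M.graph.bondSpace := by
  classical
  intro A hA
  rw [mem_ker_cMap_iff b hP hM] at hA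
  obtain ⟨hper, hinj⟩ := zigzagFlag_period b hM
  obtain ⟨ψ, hψ⟩ := exists_potential_on_corners b hM A
  have hrep := exists_zigzagFlag_eq_or_z b hM (two_mul_card_pos b M) hper
  -- `ψ` is constant on `a`-edges: they join the end of one step of the zigzag to the start of the
  -- next one, and the potential returns to 0 after a full turn.
  have ha : ∀ x, ψ (M.a x) = ψ x := by
    have step : ∀ k < 2 * Fintype.card E,
        ψ (M.a (M.z (M.zigzagFlag b k))) = ψ (M.z (M.zigzagFlag b k)) := by
      intro k hk
      rw [← zigzagFlag_succ, (hψ k hk).2]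
      obtain h | h := (Nat.succ_le_of_lt hk).eq_or_lt
      · have h0 := (hψ 0 (two_mul_card_pos b M)).1
        rw [show k + 1 = 2 * Fintype.card E from h, hper, potential_period b hM]
        exact h0
      · exact (hψ _ h).1
    intro x
    obtain ⟨k, hk, rfl | rfl⟩ := hrep x
    · obtain ⟨l, hl, hkl⟩ : ∃ l < 2 * Fintype.card E,
          M.zigzagFlag b k = M.zigzagFlag b (l + 1) := by
        rcases k with _ | k
        · obtain ⟨n, hn⟩ : ∃ n, 2 * Fintype.card E = n + 1 :=
            ⟨_, (Nat.succ_pred_eq_of_pos (two_mul_card_pos b M)).symm⟩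
          exact ⟨n, by omega, by rw [← hn, hper]; rfl⟩
        · exact ⟨k, by omega, rfl⟩
      rw [hkl, a_zigzagFlag_succ, zigzagFlag_succ]
      exact (step l hl).symm
    · exact step k hk
  -- Both directions of traversal give `ψ (v x) = ψ x`, whichever corner is visited first.
  have hv : ∀ x, ψ (M.v x) = ψ x := by
    have hsame : ∀ k < 2 * Fintype.card E, ∀ l < 2 * Fintype.card E,
        M.zigzagFlag b l = M.v (M.zigzagFlag b k) →
        M.potential b A l = M.potential b A k := by
      intro k hk l hl h
      rcases lt_trichotomy k l with hkl | rfl | hkl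
      · exact (hA k l hkl hl).1 h
      · rfl
      · exact ((hA l k hkl hk).1 (by rw [h, M.v_invol])).symm
    have hopp : ∀ k < 2 * Fintype.card E, ∀ l < 2 * Fintype.card E,
        M.zigzagFlag b l = M.f (M.zigzagFlag b k) →
        M.potential b A l = M.potential b A (k + 1) := by
      intro k hk l hl h
      rcases lt_trichotomy k l with hkl | rfl | hkl
      · exact (hA k l hkl hl).2 h
      · exact absurd h.symm (M.f_ne _)
      · have h1 := (hA l k hkl hk).2 (by rw [h, M.f_invol])
        have hr : M.rect (M.zigzagFlag b k) = M.rect (M.zigzagFlag b l) :=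
          (M.rect_eq_iff _ _).2 (.inr (.inr (.inl h)))
        rw [potential_succ, h1, potential_succ, hr, add_assoc, CharTwo.add_self_eq_zero, add_zero]
    intro x
    obtain ⟨k, hk, rfl | rfl⟩ := hrep x
    · obtain ⟨l, hl, h | h⟩ := hrep (M.v (M.zigzagFlag b k))
      · rw [h, (hψ k hk).1, (hψ l hl).1]
        exact hsame k hk l hl h.symm
      · rw [h, (hψ k hk).1, (hψ l hl).2]
        refine (hopp l hl k hk ?_).symm
        rw [← M.v_z, ← h, M.v_invol]
    · obtain ⟨l, hl, h | h⟩ := hrep (M.v (M.z (M.zigzagFlag b k)))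
      · rw [h, (hψ k hk).2, (hψ l hl).1]
        exact hopp k hk l hl (by rw [← h, v_z])
      · rw [h, (hψ k hk).2, (hψ l hl).2]
        have h' : M.zigzagFlag b l = M.v (M.zigzagFlag b k) := by
          rw [← M.z_invol (M.zigzagFlag b l), ← h, v_z, z_f]
        have hr : M.rect (M.zigzagFlag b k) = M.rect (M.zigzagFlag b l) :=
          (M.rect_eq_iff _ _).2 (.inr (.inl h'))
        rw [potential_succ, potential_succ, hsame k hk l hl h', hr]
  let Ψ : M.VGon → ZMod 2 := Quot.lift ψ fun p q h => by
    rcases h with rfl | rfl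
    · exact (hv p).symm
    · exact (ha p).symm
  have hΨ : edgeVec {w | Ψ w = 1} = Ψ := by
    ext w
    have h01 : ∀ t : ZMod 2, t = 0 ∨ t = 1 := by decide
    rw [edgeVec_apply]
    rcases h01 (Ψ w) with h | h <;> simp [h]
  refine Submodule.subset_span ⟨{w | Ψ w = 1}, Set.subset_univ _, ?_⟩
  ext e
  obtain ⟨i, j, hocc, -⟩ := exists_occursAt_zigzagSeq b hM e
  obtain rfl : M.rect (M.zigzagFlag b i) = e := (hocc.2 i).2 (.inl rfl)
  rw [Graph.edgeVec_bondOf (isLink_graph _), ← vGon_z, hΨ]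
  change _ = ψ (M.zigzagFlag b i) + ψ (M.z (M.zigzagFlag b i))
  rw [(hψ i i.2).1, (hψ i i.2).2, potential_succ, ← add_assoc, CharTwo.add_self_eq_zero, zero_add]

theorem ker_cMap (hP : P.phial = M) (hM : M.SingleZigzag) :
    LinearMap.ker (P.cMap b) = M.graph.bondSpace :=
  (ker_cMap_le_bondSpace b hP hM).antisymm (bondSpace_le_ker_cMap b hP hM)

/-! ### The image of `c` is the cycle space -/

theorem range_cMap (hP : P.phial = M) (hM : M.SingleZigzag) :
    LinearMap.range (P.cMap b) = M.graph.cycleSpace := by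
  have : Finite M.VGon := Quot.finite _
  ext A
  rw [mem_range_iff_forall_mem_ker_dotProduct _ (cMap_symm b hP hM), ker_cMap b hP hM,
    Graph.mem_cycleSpace_iff_forall_mem_bondSpace]
  refine (and_iff_right fun e he => absurd ?_ he).symm
  obtain ⟨x, rfl⟩ := M.rect_surj e
  exact (isLink_graph x).edge_mem

end CombMap

/-- `M` is a map with a single zigzag, `M.dual` its dual `D`, `M.phial` its phial `P`, and
`M.phial.anti` is `P^∼`. The corner `b` says where and in which direction the cyclic edge sequence
of the zigzag starts. -/
theorem theorem2 {X E : Type*} [Finite X] [Fintype E] (M : CombMap X E) (hM : M.SingleZigzag)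
    (b : X) :
    LinearMap.range (M.phial.cMap b) = M.graph.cycleSpace ∧
    LinearMap.ker (M.phial.cMap b) = M.graph.bondSpace ∧
    LinearMap.range (M.phial.anti.cMap b) = M.dual.graph.cycleSpace ∧
    LinearMap.ker (M.phial.anti.cMap b) = M.dual.graph.bondSpace := by
  have hP := M.phial_phial
  have hD := M.phial_anti_phial
  exact ⟨CombMap.range_cMap b hP hM, CombMap.ker_cMap b hP hM,
    CombMap.range_cMap b hD hM.dual, CombMap.ker_cMap b hD hM.dual⟩
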